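/- Let $\mathcal{A} = \mathbb{C}[q,q^{-1}]_{(q-1)}$ be the localization of the Laurent polynomial ring $\mathbb{C}[q,q^{-1}]$ at the prime ideal generated by $q-1$, and let $l$ be a natural number. Let $\mathfrak{B}_{q,l}(\mathcal{A})$ be the unital associative $\mathcal{A}$-algebra generated by elements $\mathsf{t}_i, \mathsf{c}_i$ for $1\le i\le l-1$ subject to the relations $$(\mathsf{t}_i-q)(\mathsf{t}_i+q^{-1}) = 0,\quad \mathsf{c}_i^2=0,\quad \mathsf{c}_i \mathsf{t}_i = -q^{-1} \mathsf{c}_i,\quad \mathsf{t}_i \mathsf{c}_i = q \mathsf{c}_i \qquad (1\le i \le l-1);$$ $$\mathsf{t}_i \mathsf{t}_j = \mathsf{t}_j \mathsf{t}_i,\quad \mathsf{t}_i \mathsf{c}_j = \mathsf{c}_j \mathsf{t}_i,\quad \mathsf{c}_i \mathsf{c}_j = \mathsf{c}_j \mathsf{c}_i \qquad (1\le i,j\le l-1,\ |i-j|\ge 2);$$ $$\mathsf{t}_i \mathsf{t}_{i+1} \mathsf{t}_i = \mathsf{t}_{i+1} \mathsf{t}_i \mathsf{t}_{i+1},\quad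 \mathsf{c}_{i+1} \mathsf{c}_i \mathsf{c}_{i+1} = -\mathsf{c}_{i+1},\quad \mathsf{c}_i \mathsf{c}_{i+1} \mathsf{c}_i = - \mathsf{c}_i \qquad (1\le i \le l-2);$$ $$\mathsf{t}_i \mathsf{c}_{i+1} \mathsf{c}_i = -\mathsf{t}_{i+1} \mathsf{c}_i + (q-q^{-1}) \mathsf{c}_{i+1} \mathsf{c}_i,\quad \mathsf{c}_{i+1} \mathsf{c}_i \mathsf{t}_{i+1} = -\mathsf{c}_{i+1} \mathsf{t}_i + (q-q^{-1}) \mathsf{c}_{i+1} \mathsf{c}_i \qquad (1\le i\le l-2).$$ Let $A_l$ be Moon's periplectic Brauer algebra, that is, the unital associative $\mathbb{C}$-algebra generated by elements $s_i, e_i$ for $1\le i\le l-1$ subject to the relations $$s_i^2 = 1,\quad e_i^2=0,\quad e_i s_i = -e_i,\quad s_i e_i = e_i \qquad (1\le i \le l-1);$$ $$s_i s_j = s_j s_i,\quad s_i e_j = e_j s_i,\quad e_i e_j = e_j e_i \qquad (1\le i,j\le l-1,\ |i-j|\ge 2);$$ $$s_i s_{i+1} s_i = s_{i+1} s_i s_{i+1},\quad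 e_{i+1} e_i e_{i+1} = -e_{i+1},\quad e_i e_{i+1} e_i = - e_i \qquad (1\le i \le l-2);$$ $$s_i e_{i+1} e_i = -s_{i+1} e_i,\quad e_{i+1} e_i s_{i+1} = -e_{i+1} s_i \qquad (1\le i\le l-2).$$ Then the quotient algebra $\mathfrak{B}_{q,l}(\mathcal{A})/(q-1)\mathfrak{B}_{q,l}(\mathcal{A})$ is isomorphic to $A_l$ as a $\mathbb{C}$-algebra. -/

import Mathlib

open scoped LaurentPolynomial

noncomputable section

namespace PeriplecticBrauer

/-! ### The periplectic `q`-Brauer algebra over a commutative ring with an invertible `q` -/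

/-- The generators `t_i`, `c_i` of the periplectic `q`-Brauer algebra, `1 ≤ i ≤ l - 1`.
The index set `{1, …, l - 1}` is modelled by `Fin (l - 1)`. -/
inductive QGen (l : ℕ) : Type
  | t (i : Fin (l - 1)) : QGen l
  | c (i : Fin (l - 1)) : QGen l

section QBrauer

variable {R : Type*} [CommRing R] {l : ℕ}

/-- The free generator `t_i`. -/
def freeT (R : Type*) [CommRing R] {l : ℕ} (i : Fin (l - 1)) : FreeAlgebra R (QGen l) :=
  FreeAlgebra.ι R (QGen.t i)

/-- The free generator `c_i`. -/
def freeC (R : Type*) [CommRing R] {l : ℕ} (i : Fin (l - 1)) : FreeAlgebra R (QGen l) :=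
  FreeAlgebra.ι R (QGen.c i)

/-- The element `a` of the ground ring, as an element of the free algebra. -/
def freeScalar {R : Type*} [CommRing R] (l : ℕ) (a : R) : FreeAlgebra R (QGen l) :=
  algebraMap R (FreeAlgebra R (QGen l)) a

/-- The defining relations of the periplectic `q`-Brauer algebra. -/
inductive QRel (q : Rˣ) : FreeAlgebra R (QGen l) → FreeAlgebra R (QGen l) → Prop
  /-- `(t_i - q)(t_i + q⁻¹) = 0` -/
  | quadratic (i : Fin (l - 1)) :
      QRel q ((freeT R i - freeScalar l (q : R)) * (freeT R i + freeScalar l ((q⁻¹ : Rˣ) : R))) 0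
  /-- `c_i² = 0` -/
  | c_sq (i : Fin (l - 1)) : QRel q (freeC R i ^ 2) 0
  /-- `c_i t_i = -q⁻¹ c_i` -/
  | c_t (i : Fin (l - 1)) :
      QRel q (freeC R i * freeT R i) (-(((q⁻¹ : Rˣ) : R) • freeC R i))
  /-- `t_i c_i = q c_i` -/
  | t_c (i : Fin (l - 1)) :
      QRel q (freeT R i * freeC R i) ((q : R) • freeC R i)
  /-- `t_i t_j = t_j t_i` if `|i - j| ≥ 2` -/
  | t_t_far (i j : Fin (l - 1)) (h : 2 ≤ |(i : ℤ) - (j : ℤ)|) :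
      QRel q (freeT R i * freeT R j) (freeT R j * freeT R i)
  /-- `t_i c_j = c_j t_i` if `|i - j| ≥ 2` -/
  | t_c_far (i j : Fin (l - 1)) (h : 2 ≤ |(i : ℤ) - (j : ℤ)|) :
      QRel q (freeT R i * freeC R j) (freeC R j * freeT R i)
  /-- `c_i c_j = c_j c_i` if `|i - j| ≥ 2` -/
  | c_c_far (i j : Fin (l - 1)) (h : 2 ≤ |(i : ℤ) - (j : ℤ)|) :
      QRel q (freeC R i * freeC R j) (freeC R j * freeC R i)
  /-- `t_i t_j t_i = t_j t_i t_j` for `j = i + 1` -/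
  | braid (i j : Fin (l - 1)) (h : (j : ℕ) = i + 1) :
      QRel q (freeT R i * freeT R j * freeT R i) (freeT R j * freeT R i * freeT R j)
  /-- `c_j c_i c_j = -c_j` for `j = i + 1` -/
  | c_c_c_up (i j : Fin (l - 1)) (h : (j : ℕ) = i + 1) :
      QRel q (freeC R j * freeC R i * freeC R j) (-freeC R j)
  /-- `c_i c_j c_i = -c_i` for `j = i + 1` -/
  | c_c_c_down (i j : Fin (l - 1)) (h : (j : ℕ) = i + 1) :
      QRel q (freeC R i * freeC R j * freeC R i) (-freeC R i)
  /-- `t_i c_j c_i = -t_j c_i + (q - q⁻¹) c_j c_i` for `j = i + 1` -/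
  | t_c_c (i j : Fin (l - 1)) (h : (j : ℕ) = i + 1) :
      QRel q (freeT R i * freeC R j * freeC R i)
        (-(freeT R j * freeC R i)
          + ((q : R) - ((q⁻¹ : Rˣ) : R)) • (freeC R j * freeC R i))
  /-- `c_j c_i t_j = -c_j t_i + (q - q⁻¹) c_j c_i` for `j = i + 1` -/
  | c_c_t (i j : Fin (l - 1)) (h : (j : ℕ) = i + 1) :
      QRel q (freeC R j * freeC R i * freeT R j)
        (-(freeC R j * freeT R i)
          + ((q : R) - ((q⁻¹ : Rˣ) : R)) • (freeC R j * freeC R i))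

/-- The periplectic `q`-Brauer algebra over `R` with parameter `q ∈ Rˣ`: the unital associative
`R`-algebra given by the generators `t_i`, `c_i` and the relations `QRel`. -/
abbrev QBrauer (R : Type*) [CommRing R] (q : Rˣ) (l : ℕ) : Type _ :=
  RingQuot (QRel (R := R) (l := l) q)

end QBrauer

/-! ### Specialization: `aB` and `B / aB` -/

/-- For `a` in the ground ring `R` of an algebra `B`, the two-sided ideal `aB = {a b | b ∈ B}`. -/
def scalarIdeal {R : Type*} (B : Type*) [CommRing R] [Ring B] [Algebra R B] (a : R) : Ideal B where
  carrier := {x | ∃ b : B, x = a • b}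
  add_mem' := by
    rintro _ _ ⟨b, rfl⟩ ⟨b', rfl⟩
    exact ⟨b + b', (smul_add a b b').symm⟩
  zero_mem' := ⟨0, (smul_zero a).symm⟩
  smul_mem' := by
    rintro x _ ⟨b, rfl⟩
    exact ⟨x * b, by rw [smul_eq_mul, mul_smul_comm]⟩

instance scalarIdeal_isTwoSided {R : Type*} (B : Type*) [CommRing R] [Ring B] [Algebra R B]
    (a : R) : (scalarIdeal B a).IsTwoSided where
  mul_mem_of_left := by
    rintro _ y ⟨b, rfl⟩
    exact ⟨b * y, by rw [smul_mul_assoc]⟩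

/-! ### The ring `𝒜`, the localization of `ℂ[q, q⁻¹]` at the ideal `(q - 1)` -/

/-- The ideal of `ℂ[q, q⁻¹]` generated by `q - 1`. -/
def qSubOneIdeal : Ideal ℂ[T;T⁻¹] :=
  Ideal.span {(LaurentPolynomial.T 1 - 1 : ℂ[T;T⁻¹])}

instance qSubOneIdeal_isPrime : qSubOneIdeal.IsPrime := by
  have hp : (Ideal.span {(Polynomial.X - Polynomial.C 1 : Polynomial ℂ)}).IsPrime :=
    (Ideal.span_singleton_prime (Polynomial.X_sub_C_ne_zero 1)).2 (Polynomial.prime_X_sub_C 1)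
  have hd : Disjoint ((Submonoid.powers (Polynomial.X : Polynomial ℂ)) : Set (Polynomial ℂ))
      (Ideal.span {(Polynomial.X - Polynomial.C 1 : Polynomial ℂ)} : Set (Polynomial ℂ)) := by
    rw [Set.disjoint_left]
    rintro _ ⟨n, rfl⟩ h
    rw [SetLike.mem_coe, Ideal.mem_span_singleton, Polynomial.dvd_iff_isRoot] at h
    simp [Polynomial.IsRoot] at h
  have h := IsLocalization.isPrime_of_isPrime_disjoint
    (Submonoid.powers (Polynomial.X : Polynomial ℂ)) ℂ[T;T⁻¹] _ hp hd
  have he : qSubOneIdeal = Ideal.map (algebraMap (Polynomial ℂ) ℂ[T;T⁻¹])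
      (Ideal.span {(Polynomial.X - Polynomial.C 1 : Polynomial ℂ)}) := by
    rw [Ideal.map_span, Set.image_singleton, qSubOneIdeal]
    simp [LaurentPolynomial.algebraMap_eq_toLaurent]
  rw [he]
  exact h

/-- `𝒜 = ℂ[q, q⁻¹]_{(q - 1)}`. -/
abbrev LocA : Type := Localization.AtPrime qSubOneIdeal

/-- `q`, as a unit of `ℂ[q, q⁻¹]`. -/
def qLaurent : ℂ[T;T⁻¹]ˣ where
  val := LaurentPolynomial.T 1
  inv := LaurentPolynomial.T (-1)
  val_inv := by rw [← LaurentPolynomial.T_add]; simp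
  inv_val := by rw [← LaurentPolynomial.T_add]; simp

/-- `q`, as a unit of `𝒜`. -/
def qA : LocAˣ := Units.map (algebraMap ℂ[T;T⁻¹] LocA).toMonoidHom qLaurent

/-! ### Moon's periplectic Brauer algebra -/

/-- The generators `s_i`, `e_i` of Moon's algebra, `1 ≤ i ≤ l - 1`, indexed by `Fin (l - 1)`. -/
inductive MGen (l : ℕ) : Type
  | s (i : Fin (l - 1)) : MGen l
  | e (i : Fin (l - 1)) : MGen l

/-- The free generator `s_i`. -/
def freeS {l : ℕ} (i : Fin (l - 1)) : FreeAlgebra ℂ (MGen l) :=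
  FreeAlgebra.ι ℂ (MGen.s i)

/-- The free generator `e_i`. -/
def freeE {l : ℕ} (i : Fin (l - 1)) : FreeAlgebra ℂ (MGen l) :=
  FreeAlgebra.ι ℂ (MGen.e i)

/-- The defining relations of Moon's periplectic Brauer algebra. -/
inductive MRel {l : ℕ} : FreeAlgebra ℂ (MGen l) → FreeAlgebra ℂ (MGen l) → Prop
  /-- `s_i² = 1` -/
  | s_sq (i : Fin (l - 1)) : MRel (freeS i ^ 2) 1
  /-- `e_i² = 0` -/
  | e_sq (i : Fin (l - 1)) : MRel (freeE i ^ 2) 0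
  /-- `e_i s_i = -e_i` -/
  | e_s (i : Fin (l - 1)) : MRel (freeE i * freeS i) (-freeE i)
  /-- `s_i e_i = e_i` -/
  | s_e (i : Fin (l - 1)) : MRel (freeS i * freeE i) (freeE i)
  /-- `s_i s_j = s_j s_i` if `|i - j| ≥ 2` -/
  | s_s_far (i j : Fin (l - 1)) (h : 2 ≤ |(i : ℤ) - (j : ℤ)|) :
      MRel (freeS i * freeS j) (freeS j * freeS i)
  /-- `s_i e_j = e_j s_i` if `|i - j| ≥ 2` -/
  | s_e_far (i j : Fin (l - 1)) (h : 2 ≤ |(i : ℤ) - (j : ℤ)|) :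
      MRel (freeS i * freeE j) (freeE j * freeS i)
  /-- `e_i e_j = e_j e_i` if `|i - j| ≥ 2` -/
  | e_e_far (i j : Fin (l - 1)) (h : 2 ≤ |(i : ℤ) - (j : ℤ)|) :
      MRel (freeE i * freeE j) (freeE j * freeE i)
  /-- `s_i s_j s_i = s_j s_i s_j` for `j = i + 1` -/
  | braid (i j : Fin (l - 1)) (h : (j : ℕ) = i + 1) :
      MRel (freeS i * freeS j * freeS i) (freeS j * freeS i * freeS j)
  /-- `e_j e_i e_j = -e_j` for `j = i + 1` -/
  | e_e_e_up (i j : Fin (l - 1)) (h : (j : ℕ) = i + 1) :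
      MRel (freeE j * freeE i * freeE j) (-freeE j)
  /-- `e_i e_j e_i = -e_i` for `j = i + 1` -/
  | e_e_e_down (i j : Fin (l - 1)) (h : (j : ℕ) = i + 1) :
      MRel (freeE i * freeE j * freeE i) (-freeE i)
  /-- `s_i e_j e_i = -s_j e_i` for `j = i + 1` -/
  | s_e_e (i j : Fin (l - 1)) (h : (j : ℕ) = i + 1) :
      MRel (freeS i * freeE j * freeE i) (-(freeS j * freeE i))
  /-- `e_j e_i s_j = -e_j s_i` for `j = i + 1` -/
  | e_e_s (i j : Fin (l - 1)) (h : (j : ℕ) = i + 1) :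
      MRel (freeE j * freeE i * freeS j) (-(freeE j * freeS i))

/-- Moon's periplectic Brauer algebra `A_l` over `ℂ`: the unital associative `ℂ`-algebra given by
the generators `s_i`, `e_i` and the relations `MRel`. -/
abbrev MoonAlgebra (l : ℕ) : Type := RingQuot (MRel (l := l))

end PeriplecticBrauer

end

open scoped LaurentPolynomial

noncomputable section

namespace PeriplecticBrauer

/-! ### Evaluation at `q = 1` -/

/-! Reduction modulo `q - 1` commutes with presentations by generators and relations. At `q = 1`
both `q` and `q⁻¹` become `1`, the correction terms with coefficient `q - q⁻¹` vanish, and `(t -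
1)(t + 1) = 0` reads `t² = 1`, so the relations become exactly Moon's. Thus `t_i ↔ s_i`, `c_i ↔ e_i`
define mutually inverse homomorphisms; no basis or freeness statement is needed.

The content lies in the scalars: one algebra is presented over `𝒜`, the other over `ℂ`. Evaluation
`evalOne : 𝒜 → ℂ` makes Moon's algebra an `𝒜`-algebra, while `locA_ringHom_eq_of_q_one` shows that
on the quotient, where `q = 1`, each `a ∈ 𝒜` acts as the complex number `evalOne a`. Hence maps in
both directions are linear over both rings. -/

/-- Evaluation of Laurent polynomials at `q = 1`. -/
def evalOneLaurent : ℂ[T;T⁻¹] →+* ℂ :=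
  LaurentPolynomial.eval₂ (RingHom.id ℂ) 1

lemma evalOneLaurent_C (z : ℂ) : evalOneLaurent (LaurentPolynomial.C z) = z := by
  simp [evalOneLaurent]

lemma evalOneLaurent_T (n : ℤ) : evalOneLaurent (LaurentPolynomial.T n) = 1 := by
  simp [evalOneLaurent]

lemma laurent_ringHom_ext {S : Type*} [Semiring S] {f g : ℂ[T;T⁻¹] →+* S}
    (hC : ∀ z, f (LaurentPolynomial.C z) = g (LaurentPolynomial.C z))
    (hT : ∀ n, f (LaurentPolynomial.T n) = g (LaurentPolynomial.T n)) : f = g := by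
  refine RingHom.ext fun p => ?_
  induction p using LaurentPolynomial.induction_on' with
  | add p r hp hr => rw [map_add, map_add, hp, hr]
  | C_mul_T n a => rw [map_mul, map_mul, hC, hT]

/-- A ring homomorphism out of `ℂ[q, q⁻¹]` that sends `q` to `1` factors through evaluation. -/
lemma laurent_ringHom_eq_of_T_one {S : Type*} [Semiring S] (f : ℂ[T;T⁻¹] →+* S)
    (hf : f (LaurentPolynomial.T 1) = 1) (p : ℂ[T;T⁻¹]) :
    f p = f (LaurentPolynomial.C (evalOneLaurent p)) := by
  -- The inverse of `q` also goes to `1`, as the downward half of the integer induction requires.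
  have hneg : f (LaurentPolynomial.T (-1)) = 1 := by
    have h : f (LaurentPolynomial.T 1 * LaurentPolynomial.T (-1)) = 1 := by
      rw [← LaurentPolynomial.T_add]; simp
    rwa [map_mul, hf, one_mul] at h
  have hT : ∀ n : ℤ, f (LaurentPolynomial.T n) = 1 := by
    intro n
    induction n using Int.induction_on with
    | zero => simp
    | succ i hi => rw [LaurentPolynomial.T_add, map_mul, hi, hf, one_mul]
    | pred i hi => rw [sub_eq_add_neg, LaurentPolynomial.T_add, map_mul, hi, hneg, one_mul]
  have h : f = (f.comp LaurentPolynomial.C).comp evalOneLaurent := by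
    refine laurent_ringHom_ext (fun z => ?_) (fun n => ?_)
    · simp [evalOneLaurent_C]
    · simp [evalOneLaurent_T, hT]
  exact DFunLike.congr_fun h p

/-- Modulo `q - 1` every Laurent polynomial is congruent to its value at `1`, by the factorization
lemma applied to the quotient map. A polynomial vanishing at `1` therefore lies in the ideal, and no
division is needed. -/
lemma isUnit_evalOneLaurent (s : qSubOneIdeal.primeCompl) : IsUnit (evalOneLaurent s) := by
  rw [isUnit_iff_ne_zero]
  intro h
  have hT : Ideal.Quotient.mk qSubOneIdeal (LaurentPolynomial.T 1) = 1 := by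
    rw [← map_one (Ideal.Quotient.mk qSubOneIdeal), Ideal.Quotient.eq]
    exact Ideal.mem_span_singleton_self _
  have hs := laurent_ringHom_eq_of_T_one _ hT (s : ℂ[T;T⁻¹])
  rw [h, map_zero, map_zero, Ideal.Quotient.eq_zero_iff_mem] at hs
  exact s.2 hs

/-- Evaluation `𝒜 → ℂ` at `q = 1`. -/
def evalOne : LocA →+* ℂ :=
  IsLocalization.lift (M := qSubOneIdeal.primeCompl) isUnit_evalOneLaurent

lemma evalOne_algebraMap_laurent (p : ℂ[T;T⁻¹]) :
    evalOne (algebraMap ℂ[T;T⁻¹] LocA p) = evalOneLaurent p :=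
  IsLocalization.lift_eq _ _

lemma algebraMap_complex_locA (z : ℂ) :
    algebraMap ℂ LocA z = algebraMap ℂ[T;T⁻¹] LocA (LaurentPolynomial.C z) := by
  rw [IsScalarTower.algebraMap_apply ℂ ℂ[T;T⁻¹] LocA]
  rfl

lemma evalOne_algebraMap (z : ℂ) : evalOne (algebraMap ℂ LocA z) = z := by
  rw [algebraMap_complex_locA, evalOne_algebraMap_laurent, evalOneLaurent_C]

lemma qA_val : (qA : LocA) = algebraMap ℂ[T;T⁻¹] LocA (LaurentPolynomial.T 1) := rfl

lemma evalOne_qA : evalOne (qA : LocA) = 1 := by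
  rw [qA_val, evalOne_algebraMap_laurent, evalOneLaurent_T]

lemma evalOne_qA_inv : evalOne ((qA⁻¹ : LocAˣ) : LocA) = 1 := by
  have h : evalOne ((qA : LocA) * ((qA⁻¹ : LocAˣ) : LocA)) = 1 := by simp
  rwa [map_mul, evalOne_qA, one_mul] at h

/-- A ring homomorphism out of `𝒜` that sends `q` to `1` factors through evaluation. -/
lemma locA_ringHom_eq_of_q_one {S : Type*} [Semiring S] (f : LocA →+* S)
    (hf : f (qA : LocA) = 1) (a : LocA) :
    f a = f (algebraMap ℂ LocA (evalOne a)) := by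
  have h : f = (f.comp (algebraMap ℂ LocA)).comp evalOne := by
    -- Homomorphisms out of a localization are determined on `ℂ[q, q⁻¹]`, where the Laurent version
    -- applies.
    refine IsLocalization.ringHom_ext qSubOneIdeal.primeCompl (RingHom.ext fun p => ?_)
    have := laurent_ringHom_eq_of_T_one (f.comp (algebraMap ℂ[T;T⁻¹] LocA)) hf p
    simpa [evalOne_algebraMap_laurent, algebraMap_complex_locA] using this
  exact DFunLike.congr_fun h a

/-! ### From the `q`-Brauer algebra to Moon's algebra -/

section Moon

variable {l : ℕ}

/-- The generator `s_i` of Moon's algebra. -/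
def moonS (i : Fin (l - 1)) : MoonAlgebra l := RingQuot.mkAlgHom ℂ MRel (freeS i)

/-- The generator `e_i` of Moon's algebra. -/
def moonE (i : Fin (l - 1)) : MoonAlgebra l := RingQuot.mkAlgHom ℂ MRel (freeE i)

/-- The images of the generators of the `q`-Brauer algebra in Moon's algebra. -/
def moonOfQGen : QGen l → MoonAlgebra l
  | .t i => moonS i
  | .c i => moonE i

/-- Moon's algebra as an `𝒜`-algebra, through evaluation at `q = 1`. -/
abbrev moonAlgebraLocA : Algebra LocA (MoonAlgebra l) := Algebra.compHom (MoonAlgebra l) evalOne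

attribute [local instance] moonAlgebraLocA

lemma locA_smul_moon (a : LocA) (x : MoonAlgebra l) : a • x = evalOne a • x := rfl

lemma algebraMap_locA_moon (a : LocA) :
    algebraMap LocA (MoonAlgebra l) a = algebraMap ℂ (MoonAlgebra l) (evalOne a) := rfl

/-- Since `𝒜` acts on Moon's algebra through `evalOne`, each `q`-relation specializes to the Moon
relation of the same shape; only the quadratic one needs rewriting, as `(s - 1)(s + 1) = s² - 1`. -/
lemma lift_moonOfQGen_rel {x y : FreeAlgebra LocA (QGen l)} (h : QRel qA x y) :
    FreeAlgebra.lift LocA (moonOfQGen (l := l)) x = FreeAlgebra.lift LocA moonOfQGen y := by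
  have rel : ∀ {x y : FreeAlgebra ℂ (MGen l)}, MRel x y →
      RingQuot.mkAlgHom ℂ MRel x = RingQuot.mkAlgHom ℂ MRel y :=
    fun h => RingQuot.mkAlgHom_rel ℂ h
  have hms : ∀ i : Fin (l - 1), RingQuot.mkAlgHom ℂ MRel (freeS i) = moonS i := fun _ => rfl
  have hme : ∀ i : Fin (l - 1), RingQuot.mkAlgHom ℂ MRel (freeE i) = moonE i := fun _ => rfl
  have ht : ∀ i : Fin (l - 1),
      FreeAlgebra.lift LocA (moonOfQGen (l := l)) (freeT LocA i) = moonS i :=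
    fun i => FreeAlgebra.lift_ι_apply _ _
  have hc : ∀ i : Fin (l - 1),
      FreeAlgebra.lift LocA (moonOfQGen (l := l)) (freeC LocA i) = moonE i :=
    fun i => FreeAlgebra.lift_ι_apply _ _
  have hs : ∀ a : LocA, FreeAlgebra.lift LocA (moonOfQGen (l := l)) (freeScalar l a) =
      algebraMap ℂ (MoonAlgebra l) (evalOne a) := fun a => AlgHom.commutes _ a
  cases h with
  | quadratic i =>
    have h := rel (MRel.s_sq i)
    simp only [map_pow, map_one, hms] at h
    simp only [map_mul, map_sub, map_add, ht, hs, evalOne_qA, evalOne_qA_inv, map_one, map_zero]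
    rw [sub_mul, mul_add, ← sq, h]
    noncomm_ring
  | c_sq i => simpa only [hms, hme, map_pow, map_zero, hc] using rel (MRel.e_sq i)
  | c_t i =>
    simpa only [hms, hme, map_mul, map_neg, map_smul, hc, ht, locA_smul_moon, evalOne_qA_inv, one_smul]
      using rel (MRel.e_s i)
  | t_c i =>
    simpa only [hms, hme, map_mul, map_smul, hc, ht, locA_smul_moon, evalOne_qA, one_smul]
      using rel (MRel.s_e i)
  | t_t_far i j h => simpa only [hms, hme, map_mul, ht] using rel (MRel.s_s_far i j h)
  | t_c_far i j h => simpa only [hms, hme, map_mul, ht, hc] using rel (MRel.s_e_far i j h)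
  | c_c_far i j h => simpa only [hms, hme, map_mul, hc] using rel (MRel.e_e_far i j h)
  | braid i j h => simpa only [hms, hme, map_mul, ht] using rel (MRel.braid i j h)
  | c_c_c_up i j h => simpa only [hms, hme, map_mul, map_neg, hc] using rel (MRel.e_e_e_up i j h)
  | c_c_c_down i j h => simpa only [hms, hme, map_mul, map_neg, hc] using rel (MRel.e_e_e_down i j h)
  | t_c_c i j h =>
    simpa only [hms, hme, map_mul, map_neg, map_add, map_smul, ht, hc, locA_smul_moon, map_sub, evalOne_qA,
      evalOne_qA_inv, sub_self, zero_smul, add_zero] using rel (MRel.s_e_e i j h)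
  | c_c_t i j h =>
    simpa only [hms, hme, map_mul, map_neg, map_add, map_smul, ht, hc, locA_smul_moon, map_sub, evalOne_qA,
      evalOne_qA_inv, sub_self, zero_smul, add_zero] using rel (MRel.e_e_s i j h)

/-- The homomorphism of `𝒜`-algebras `t_i ↦ s_i`, `c_i ↦ e_i`. -/
def qBrauerToMoon (l : ℕ) : QBrauer LocA qA l →ₐ[LocA] MoonAlgebra l :=
  RingQuot.liftAlgHom LocA ⟨FreeAlgebra.lift LocA moonOfQGen, fun _ _ h => lift_moonOfQGen_rel h⟩

lemma qBrauerToMoon_mk (x : FreeAlgebra LocA (QGen l)) :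
    qBrauerToMoon l (RingQuot.mkAlgHom LocA (QRel qA) x) =
      FreeAlgebra.lift LocA moonOfQGen x :=
  RingQuot.liftAlgHom_mkAlgHom_apply _ _ _ _

/-- The specialization of the `q`-Brauer algebra at `q = 1`. -/
abbrev QBrauerAtOne (l : ℕ) : Type _ :=
  QBrauer LocA qA l ⧸ scalarIdeal (QBrauer LocA qA l) ((qA : LocA) - 1)

/-- The homomorphism from the specialization at `q = 1` to Moon's algebra. -/
def specializationToMoon (l : ℕ) : QBrauerAtOne l →ₐ[LocA] MoonAlgebra l :=
  Ideal.Quotient.liftₐ _ (qBrauerToMoon l) (by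
    rintro _ ⟨b, rfl⟩
    -- The ideal dies because `q - 1` acts on the target as `evalOne (q - 1) = 0`.
    rw [map_smul, locA_smul_moon, map_sub, evalOne_qA, map_one, sub_self, zero_smul])

/-- The quotient map from the free algebra to the specialization at `q = 1`. -/
def freeToSpecialization (l : ℕ) : FreeAlgebra LocA (QGen l) →ₐ[LocA] QBrauerAtOne l :=
  (Ideal.Quotient.mkₐ LocA _).comp (RingQuot.mkAlgHom LocA (QRel qA))

lemma specializationToMoon_free (x : FreeAlgebra LocA (QGen l)) :
    specializationToMoon l (freeToSpecialization l x) = FreeAlgebra.lift LocA moonOfQGen x :=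
  qBrauerToMoon_mk x

lemma freeToSpecialization_rel {x y : FreeAlgebra LocA (QGen l)} (h : QRel qA x y) :
    freeToSpecialization l x = freeToSpecialization l y :=
  congrArg (Ideal.Quotient.mkₐ LocA _) (RingQuot.mkAlgHom_rel LocA h)

/-! ### From Moon's algebra to the specialization at `q = 1` -/

lemma algebraMap_qA_specialization : algebraMap LocA (QBrauerAtOne l) (qA : LocA) = 1 := by
  have h : Ideal.Quotient.mk (scalarIdeal (QBrauer LocA qA l) ((qA : LocA) - 1))
      (algebraMap LocA (QBrauer LocA qA l) (qA : LocA)) = Ideal.Quotient.mk _ 1 := by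
    rw [Ideal.Quotient.eq]
    exact ⟨1, by rw [← Algebra.algebraMap_eq_smul_one, map_sub, map_one]⟩
  rwa [map_one] at h

lemma algebraMap_complex_specialization (z : ℂ) :
    algebraMap ℂ (QBrauerAtOne l) z =
      algebraMap LocA (QBrauerAtOne l) (algebraMap ℂ LocA z) := rfl

/-- The structure map of the quotient sends `q` to `1`, so it factors through evaluation. This turns
the `𝒜`-coefficients of the `q`-relations into complex ones. -/
lemma algebraMap_specialization (a : LocA) :
    algebraMap LocA (QBrauerAtOne l) a = algebraMap ℂ (QBrauerAtOne l) (evalOne a) :=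
  locA_ringHom_eq_of_q_one _ algebraMap_qA_specialization a

lemma locA_smul_specialization (a : LocA) (x : QBrauerAtOne l) : a • x = evalOne a • x := by
  rw [Algebra.smul_def, Algebra.smul_def, algebraMap_specialization]

/-- The images of the generators of Moon's algebra in the specialization at `q = 1`. -/
def specializationOfMGen : MGen l → QBrauerAtOne l
  | .s i => freeToSpecialization l (freeT LocA i)
  | .e i => freeToSpecialization l (freeC LocA i)

lemma lift_specializationOfMGen_rel {x y : FreeAlgebra ℂ (MGen l)} (h : MRel x y) :
    FreeAlgebra.lift ℂ (specializationOfMGen (l := l)) x =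
      FreeAlgebra.lift ℂ specializationOfMGen y := by
  have hs : ∀ i : Fin (l - 1), FreeAlgebra.lift ℂ (specializationOfMGen (l := l)) (freeS i) =
      freeToSpecialization l (freeT LocA i) := fun i => FreeAlgebra.lift_ι_apply _ _
  have he : ∀ i : Fin (l - 1), FreeAlgebra.lift ℂ (specializationOfMGen (l := l)) (freeE i) =
      freeToSpecialization l (freeC LocA i) := fun i => FreeAlgebra.lift_ι_apply _ _
  have hsc : ∀ a : LocA, freeToSpecialization l (freeScalar l a) =
      algebraMap ℂ (QBrauerAtOne l) (evalOne a) :=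
    fun a => (AlgHom.commutes _ a).trans (algebraMap_specialization a)
  cases h with
  | s_sq i =>
    have h := freeToSpecialization_rel (QRel.quadratic (q := qA) i)
    simp only [map_mul, map_sub, map_add, hsc, evalOne_qA, evalOne_qA_inv, map_one, map_zero] at h
    simp only [map_pow, map_one, hs]
    -- The goal becomes `t² - 1 = (t - 1)(t + 1)`.
    rw [← sub_eq_zero, ← h]
    noncomm_ring
  | e_sq i =>
    simpa only [map_pow, map_zero, he] using freeToSpecialization_rel (QRel.c_sq (q := qA) i)
  | e_s i =>
    simpa only [map_mul, map_neg, map_smul, he, hs, locA_smul_specialization, evalOne_qA_inv,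
      one_smul] using freeToSpecialization_rel (QRel.c_t (q := qA) i)
  | s_e i =>
    simpa only [map_mul, map_smul, he, hs, locA_smul_specialization, evalOne_qA,
      one_smul] using freeToSpecialization_rel (QRel.t_c (q := qA) i)
  | s_s_far i j h =>
    simpa only [map_mul, hs] using freeToSpecialization_rel (QRel.t_t_far (q := qA) i j h)
  | s_e_far i j h =>
    simpa only [map_mul, hs, he] using freeToSpecialization_rel (QRel.t_c_far (q := qA) i j h)
  | e_e_far i j h =>
    simpa only [map_mul, he] using freeToSpecialization_rel (QRel.c_c_far (q := qA) i j h)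
  | braid i j h =>
    simpa only [map_mul, hs] using freeToSpecialization_rel (QRel.braid (q := qA) i j h)
  | e_e_e_up i j h =>
    simpa only [map_mul, map_neg, he] using
      freeToSpecialization_rel (QRel.c_c_c_up (q := qA) i j h)
  | e_e_e_down i j h =>
    simpa only [map_mul, map_neg, he] using
      freeToSpecialization_rel (QRel.c_c_c_down (q := qA) i j h)
  | s_e_e i j h =>
    simpa only [map_mul, map_neg, map_add, map_smul, hs, he, locA_smul_specialization, map_sub,
      evalOne_qA, evalOne_qA_inv, sub_self, zero_smul, add_zero] using
      freeToSpecialization_rel (QRel.t_c_c (q := qA) i j h)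
  | e_e_s i j h =>
    simpa only [map_mul, map_neg, map_add, map_smul, hs, he, locA_smul_specialization, map_sub,
      evalOne_qA, evalOne_qA_inv, sub_self, zero_smul, add_zero] using
      freeToSpecialization_rel (QRel.c_c_t (q := qA) i j h)

/-- The homomorphism of `ℂ`-algebras `s_i ↦ t_i`, `e_i ↦ c_i`. -/
def moonToSpecialization (l : ℕ) : MoonAlgebra l →ₐ[ℂ] QBrauerAtOne l :=
  RingQuot.liftAlgHom ℂ
    ⟨FreeAlgebra.lift ℂ specializationOfMGen, fun _ _ h => lift_specializationOfMGen_rel h⟩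

lemma moonToSpecialization_mk (x : FreeAlgebra ℂ (MGen l)) :
    moonToSpecialization l (RingQuot.mkAlgHom ℂ MRel x) =
      FreeAlgebra.lift ℂ specializationOfMGen x :=
  RingQuot.liftAlgHom_mkAlgHom_apply _ _ _ _

/-! ### The isomorphism -/

/-- `specializationToMoon` as a homomorphism of `ℂ`-algebras. -/
def specializationToMoonComplex (l : ℕ) : QBrauerAtOne l →ₐ[ℂ] MoonAlgebra l :=
  { (specializationToMoon l : QBrauerAtOne l →+* MoonAlgebra l) with
    commutes' := fun z => by
      change specializationToMoon l (algebraMap ℂ (QBrauerAtOne l) z) = _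
      rw [algebraMap_complex_specialization, AlgHom.commutes, algebraMap_locA_moon,
        evalOne_algebraMap] }

/-- `moonToSpecialization` as a homomorphism of `𝒜`-algebras. -/
def moonToSpecializationLocA (l : ℕ) : MoonAlgebra l →ₐ[LocA] QBrauerAtOne l :=
  { (moonToSpecialization l : MoonAlgebra l →+* QBrauerAtOne l) with
    commutes' := fun a => by
      change moonToSpecialization l (algebraMap LocA (MoonAlgebra l) a) = _
      rw [algebraMap_locA_moon, AlgHom.commutes, algebraMap_specialization] }

lemma specializationToMoon_comp_moonToSpecialization :
    (specializationToMoonComplex l).comp (moonToSpecialization l) = AlgHom.id ℂ _ := by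
  refine RingQuot.ringQuot_ext' ℂ _ _ (FreeAlgebra.hom_ext (funext fun g => ?_))
  change specializationToMoon l (moonToSpecialization l
    (RingQuot.mkAlgHom ℂ MRel (FreeAlgebra.ι ℂ g))) = RingQuot.mkAlgHom ℂ MRel (FreeAlgebra.ι ℂ g)
  rw [moonToSpecialization_mk, FreeAlgebra.lift_ι_apply]
  cases g with
  | s i => exact (specializationToMoon_free _).trans (FreeAlgebra.lift_ι_apply _ _)
  | e i => exact (specializationToMoon_free _).trans (FreeAlgebra.lift_ι_apply _ _)

/-- Uniqueness of maps out of the free `𝒜`-algebra requires `𝒜`-linearity, so the composite is taken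
with `moonToSpecializationLocA`; it then suffices that it fixes the generators. -/
lemma moonToSpecialization_comp_free :
    ((moonToSpecializationLocA l).comp (specializationToMoon l)).comp (freeToSpecialization l) =
      freeToSpecialization l := by
  refine FreeAlgebra.hom_ext (funext fun g => ?_)
  change moonToSpecialization l (specializationToMoon l
    (freeToSpecialization l (FreeAlgebra.ι LocA g))) = freeToSpecialization l (FreeAlgebra.ι LocA g)
  rw [specializationToMoon_free, FreeAlgebra.lift_ι_apply]
  cases g with
  | t i => exact (moonToSpecialization_mk _).trans (FreeAlgebra.lift_ι_apply _ _)
  | c i => exact (moonToSpecialization_mk _).trans (FreeAlgebra.lift_ι_apply _ _)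

lemma freeToSpecialization_surjective : Function.Surjective (freeToSpecialization l) :=
  Ideal.Quotient.mk_surjective.comp (RingQuot.mkAlgHom_surjective LocA _)

lemma moonToSpecialization_comp_specializationToMoon :
    (moonToSpecialization l).comp (specializationToMoonComplex l) = AlgHom.id ℂ _ := by
  ext x
  -- The `ℂ`-linear and `𝒜`-linear versions have the same underlying functions, so the identity
  -- checked on the free algebra descends along this surjection.
  obtain ⟨y, rfl⟩ := freeToSpecialization_surjective x
  exact DFunLike.congr_fun moonToSpecialization_comp_free y

/-- The specialization of the `q`-Brauer algebra at `q = 1` is Moon's algebra. -/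
def specializationEquivMoon (l : ℕ) : QBrauerAtOne l ≃ₐ[ℂ] MoonAlgebra l :=
  AlgEquiv.ofAlgHom (specializationToMoonComplex l) (moonToSpecialization l)
    specializationToMoon_comp_moonToSpecialization
    moonToSpecialization_comp_specializationToMoon

end Moon

end PeriplecticBrauer

end

theorem proposition5p5 (l : ℕ) :
    Nonempty
      ((PeriplecticBrauer.QBrauer PeriplecticBrauer.LocA PeriplecticBrauer.qA l ⧸
          PeriplecticBrauer.scalarIdeal
            (PeriplecticBrauer.QBrauer PeriplecticBrauer.LocA PeriplecticBrauer.qA l)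
            ((PeriplecticBrauer.qA : PeriplecticBrauer.LocA) - 1))
        ≃ₐ[ℂ] PeriplecticBrauer.MoonAlgebra l) :=
  ⟨PeriplecticBrauer.specializationEquivMoon l⟩
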